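/- Theorem 2. Consider a finite POMDP with state set $\mathcal S$, action set $Act$, observation set $\mathcal O$, transition probabilities $T(s'\mid s,\alpha)$ and observation probabilities $O(o\mid s)$. Let $\Delta(\mathcal S)$ be the probability simplex over $\mathcal S$ and let $b_0\in\Delta(\mathcal S)$ be the initial belief. For a policy $\pi$ (history-dependent, possibly randomized), let $h_t=(\alpha_0,o_1,\dots,\alpha_{t-1},o_t)$ be the history and let $b_t\in\Delta(\mathcal S)$ be the belief obtained from it by Bayes' rule. Let $$p(b'\mid b,\alpha)=\sum_{o\in\mathcal O}\delta\big(b'-\tau(b,\alpha,o)\big)\,p(o\mid b,\alpha),\qquad p(o\mid b,\alpha)=\sum_{s}O(o\mid s)\sum_{s'}T(s\mid s',\alpha)b(s'),$$ be the belief transition kernel, where $\delta(0)=1$, $\delta(x)=0$ for $x\ne 0$, and $\tau(b,\alpha,o)(s)=O(o\mid s)\sum_{s'}T(s\mid s',\alpha)b(s')/p(o\mid b,\alpha)$. Let $\gamma\in(0,1)$, let $c,d^1,\dots,d^{n_c}:\mathcal S\times Act\to[0,\infty)$ be (bounded) costs, $\beta\in\mathbb R^{n_c}$, and put $c(b,\alpha)=\sum_s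 c(s,\alpha)b(s)$, $d^i(b,\alpha)=\sum_s d^i(s,\alpha)b(s)$. Let a class of admissible policies be given. For each admissible $\pi$ let $\rho_t=\rho_t^\pi:\mathcal C_{t+1}\to\mathcal C_t$, $t\ge0$, be one-step conditional risk measures, where $\mathcal C_0=\mathbb R$ and, for $t\ge 0$, $\mathcal C_{t+1}$ is the space of random variables that are functions of $(h_t,\alpha_t)$. Assume that each $\rho_t$ is coherent (almost surely convex, monotone, translation invariant with respect to $\mathcal C_t$, and positively homogeneous) and that the $\rho_t$ are Markov risk measures for the belief process with a common risk transition mapping $\sigma$: for all bounded measurable $v:\Delta(\mathcal S)\to\mathbb R$ and all $t\ge0$, the risk of $v(b_{t+1})$ conditional on $(h_t,\alpha_t)$ equals $\sigma\{v,b_t,p(\cdot\mid b_t,\alpha_t)\}$ almost surely. For a cost function $g$ put $$\rho^{\gamma}(g)=\lim_{t\to\infty}\rho_0\Big(g(b_0,\alpha_0)+\rho_1\big(\gamma g(b_1,\alpha_1)+\cdots+\rho_t(\gamma^t g(b_t,\alpha_t))\cdots\big)\Big),$$ and let $J_\gamma(b_0)=\inf\{\rho^\gamma(c):\pi\text{ admissible},\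 \rho^\gamma(d^i)\le\beta^i,\ i=1,\dots,n_c\}$ ($+\infty$ if no admissible policy satisfies the constraints). Consider the optimization problem over bounded measurable $V:\Delta(\mathcal S)\to\mathbb R$ and $\lambda\in\mathbb R^{n_c}$ $$\sup_{V,\;\lambda\succeq0}\ \langle b_0,V\rangle-\langle\lambda,\beta\rangle\quad\text{subject to}\quad V(b)\le c(b,\alpha)+\langle\lambda,d(b,\alpha)\rangle+\gamma\,\sigma\{V,b,p(\cdot\mid b,\alpha)\}\quad\forall b\in\Delta(\mathcal S),\ \forall\alpha\in Act,$$ where $\langle b_0,V\rangle$ denotes the value $V(b_0)$ at the initial belief. Then the limits $\rho^\gamma(c)$ and $\rho^\gamma(d^i)$ exist for every admissible policy, every solution $(V^*,\lambda^*)$ of the problem satisfies $$J_\gamma(b_0)\ \ge\ \langle b_0,V^*\rangle-\langle\lambda^*,\beta\rangle,$$ and the supremum of the problem is at most $J_\gamma(b_0)$ whether or not it is attained. -/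

import Mathlib

open Filter Topology

noncomputable section

/-- A finite POMDP: transition probabilities `trans s a s' = T(s' | s, a)` and observation
probabilities `obs s o = O(o | s)`, each a point of a probability simplex. -/
structure POMDP (S Act Ob : Type*) [Fintype S] [Fintype Ob] where
  /-- transition function `T` -/
  trans : S → Act → stdSimplex ℝ S
  /-- observation model `O` -/
  obs : S → stdSimplex ℝ Ob

namespace POMDP

variable {S Act Ob : Type*} [Fintype S] [Fintype Ob]

/-! ### Beliefs and the belief MDP -/

/-- The law of the next state, when the current belief is `b` and action `a` is taken. -/
def predict (P : POMDP S Act Ob) (b : stdSimplex ℝ S) (a : Act) (s' : S) : ℝ :=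
  ∑ s, P.trans s a s' * b s

/-- The probability `p(o | b, a)` of the next observation. -/
def obsProb (P : POMDP S Act Ob) (b : stdSimplex ℝ S) (a : Act) (o : Ob) : ℝ :=
  ∑ s', P.obs s' o * P.predict b a s'

theorem predict_nonneg (P : POMDP S Act Ob) (b : stdSimplex ℝ S) (a : Act) (s' : S) :
    0 ≤ P.predict b a s' :=
  Finset.sum_nonneg fun s _ => mul_nonneg ((P.trans s a).2.1 s') (b.2.1 s)

theorem obsProb_nonneg (P : POMDP S Act Ob) (b : stdSimplex ℝ S) (a : Act) (o : Ob) :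
    0 ≤ P.obsProb b a o :=
  Finset.sum_nonneg fun s' _ => mul_nonneg ((P.obs s').2.1 o) (P.predict_nonneg b a s')

theorem sum_obsProb (P : POMDP S Act Ob) (b : stdSimplex ℝ S) (a : Act) :
    ∑ o, P.obsProb b a o = 1 := by
  unfold obsProb predict
  rw [Finset.sum_comm]
  simp_rw [← Finset.sum_mul, stdSimplex.sum_eq_one, one_mul]
  rw [Finset.sum_comm]
  simp_rw [← Finset.sum_mul, stdSimplex.sum_eq_one, one_mul]
  exact b.2.2

open Classical in
/-- Bayes' rule: the belief after taking action `a` at belief `b` and then observing `o`. If `o` has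
probability zero the value is irrelevant, and `b` is kept. -/
def update (P : POMDP S Act Ob) (b : stdSimplex ℝ S) (a : Act) (o : Ob) : stdSimplex ℝ S :=
  if h : P.obsProb b a o = 0 then b
  else ⟨fun s' => P.obs s' o * P.predict b a s' / P.obsProb b a o,
    fun s' => div_nonneg (mul_nonneg ((P.obs s').2.1 o) (P.predict_nonneg b a s'))
      (P.obsProb_nonneg b a o),
    by rw [← Finset.sum_div]; exact div_self h⟩

/-- The law of the next observation as a `PMF`. -/
def obsPMF (P : POMDP S Act Ob) (b : stdSimplex ℝ S) (a : Act) : PMF Ob :=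
  PMF.ofFintype (fun o => ENNReal.ofReal (P.obsProb b a o)) (by
    rw [← ENNReal.ofReal_sum_of_nonneg fun o _ => P.obsProb_nonneg b a o, P.sum_obsProb,
      ENNReal.ofReal_one])

/-- The controlled belief transition kernel
`p(b' | b, a) = ∑ o, δ (b' - update b a o) * p(o | b, a)`. -/
def beliefKernel (P : POMDP S Act Ob) (b : stdSimplex ℝ S) (a : Act) : PMF (stdSimplex ℝ S) :=
  (P.obsPMF b a).map (P.update b a)

/-- The belief-averaged cost `c(b, a) = ∑ s, c(s, a) b(s)`. -/
def beliefCost (c : S → Act → ℝ) (b : stdSimplex ℝ S) (a : Act) : ℝ :=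
  ∑ s, c s a * b s

end POMDP

/-! ### Histories, policies and the probability of histories -/

/-- What has been seen before the action at time `t` is chosen: the actions `a_0, …, a_{t-1}` and the
observations `o_1, …, o_t`. -/
inductive Hist (Act Ob : Type*) : ℕ → Type _
  | nil : Hist Act Ob 0
  | snoc {t : ℕ} (h : Hist Act Ob t) (a : Act) (o : Ob) : Hist Act Ob (t + 1)

/-- The atoms of the filtration. At stage `0` nothing random has been revealed; at stage `t + 1` the
history before time `t` and the action `a_t` are known, hence so is the cost incurred at time `t`. -/
inductive Info (Act Ob : Type*) : ℕ → Type _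
  | start : Info Act Ob 0
  | act {t : ℕ} (h : Hist Act Ob t) (a : Act) : Info Act Ob (t + 1)

/-- The information available one stage earlier. -/
def Info.parent {Act Ob : Type*} : {t : ℕ} → Info Act Ob (t + 1) → Info Act Ob t
  | _, .act .nil _ => .start
  | _, .act (.snoc h a _) _ => .act h a

/-- A (randomized, history-dependent) policy. -/
abbrev Policy (Act Ob : Type*) [Fintype Act] : Type _ :=
  ∀ t : ℕ, Hist Act Ob t → stdSimplex ℝ Act

namespace POMDP

variable {S Act Ob : Type*} [Fintype S] [Fintype Act] [Fintype Ob]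

/-- The joint probability of a history and of the current hidden state, when `s_0 ∼ b₀`,
`a_t ∼ π_t(h_t)`, `s_{t+1} ∼ T(· | s_t, a_t)` and `o_{t+1} ∼ O(· | s_{t+1})`. -/
def jointProb (P : POMDP S Act Ob) (b₀ : stdSimplex ℝ S) (π : Policy Act Ob) :
    {t : ℕ} → Hist Act Ob t → S → ℝ
  | _, .nil, s => b₀ s
  | _, .snoc h a o, s' =>
      P.obs s' o * ∑ s, P.trans s a s' * (π _ h a * jointProb P b₀ π h s)

/-- The probability of an atom of the filtration. -/
def infoProb (P : POMDP S Act Ob) (b₀ : stdSimplex ℝ S) (π : Policy Act Ob) :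
    {t : ℕ} → Info Act Ob t → ℝ
  | _, .start => 1
  | _, .act h a => π _ h a * ∑ s, P.jointProb b₀ π h s

/-- The belief `b_t` after a history. -/
def belief (P : POMDP S Act Ob) (b₀ : stdSimplex ℝ S) : {t : ℕ} → Hist Act Ob t → stdSimplex ℝ S
  | _, .nil => b₀
  | _, .snoc h a o => P.update (belief P b₀ h) a o

/-- The belief `b_t` as a random variable on the atoms of stage `t + 1`. -/
def beliefAt (P : POMDP S Act Ob) (b₀ : stdSimplex ℝ S) (t : ℕ) :
    Info Act Ob (t + 1) → stdSimplex ℝ S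
  | .act h _ => P.belief b₀ h

/-- The cost `c(b_t, a_t)` at time `t`, a random variable on the atoms of stage `t + 1`. -/
def stageCost (P : POMDP S Act Ob) (b₀ : stdSimplex ℝ S) (c : S → Act → ℝ) (t : ℕ) :
    Info Act Ob (t + 1) → ℝ
  | .act h a => beliefCost c (P.belief b₀ h) a

end POMDP

/-! ### Coherent Markov risk measures -/

/-- A sequence of one-step conditional risk mappings `ρ_t : C_{t+1} → C_t`, where `C_t` is the space
of random variables that are known at stage `t`. -/
abbrev RiskSeq (Act Ob : Type*) : Type _ :=
  ∀ t : ℕ, (Info Act Ob (t + 1) → ℝ) → Info Act Ob t → ℝ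

namespace POMDP

variable {S Act Ob : Type*} [Fintype S] [Fintype Act] [Fintype Ob]

/-- `X ≤ Y` almost surely under the policy `π`. There are only finitely many atoms at each stage, so
this says that `X ≤ Y` on each atom of positive probability. -/
def AELe (P : POMDP S Act Ob) (b₀ : stdSimplex ℝ S) (π : Policy Act Ob) {t : ℕ}
    (X Y : Info Act Ob t → ℝ) : Prop :=
  ∀ i, 0 < P.infoProb b₀ π i → X i ≤ Y i

/-- `X = Y` almost surely under the policy `π`. -/
def AEEq (P : POMDP S Act Ob) (b₀ : stdSimplex ℝ S) (π : Policy Act Ob) {t : ℕ}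
    (X Y : Info Act Ob t → ℝ) : Prop :=
  ∀ i, 0 < P.infoProb b₀ π i → X i = Y i

/-- Each `ρ_t` is a coherent one-step conditional risk measure, with respect to the law of the
process under the policy `π`. -/
structure IsCoherent (P : POMDP S Act Ob) (b₀ : stdSimplex ℝ S) (π : Policy Act Ob)
    (ρ : RiskSeq Act Ob) : Prop where
  convex : ∀ (t : ℕ) (μ : ℝ), 0 < μ → μ < 1 → ∀ X Y : Info Act Ob (t + 1) → ℝ,
    P.AELe b₀ π (ρ t (μ • X + (1 - μ) • Y)) (μ • ρ t X + (1 - μ) • ρ t Y)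
  monotone : ∀ (t : ℕ) (X Y : Info Act Ob (t + 1) → ℝ),
    P.AELe b₀ π X Y → P.AELe b₀ π (ρ t X) (ρ t Y)
  translation : ∀ (t : ℕ) (X : Info Act Ob t → ℝ) (Y : Info Act Ob (t + 1) → ℝ),
    P.AEEq b₀ π (ρ t ((fun i => X i.parent) + Y)) (X + ρ t Y)
  homogeneous : ∀ (t : ℕ) (r : ℝ), 0 ≤ r → ∀ X : Info Act Ob (t + 1) → ℝ,
    P.AEEq b₀ π (ρ t (r • X)) (r • ρ t X)

/-- `V` is a bounded measurable function on the belief simplex. -/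
def IsValueFun (V : stdSimplex ℝ S → ℝ) : Prop :=
  Measurable V ∧ ∃ C : ℝ, ∀ b, |V b| ≤ C

/-- The `ρ_t` are Markov risk measures with respect to the belief process, with risk transition
mapping `σ`: given the history and the action `a_t`, the risk of `v(b_{t+1})` is
`σ(v, b_t, p(· | b_t, a_t))`. -/
def IsMarkovRisk (P : POMDP S Act Ob) (b₀ : stdSimplex ℝ S) (π : Policy Act Ob)
    (ρ : RiskSeq Act Ob)
    (σ : (stdSimplex ℝ S → ℝ) → stdSimplex ℝ S → PMF (stdSimplex ℝ S) → ℝ) : Prop :=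
  ∀ v : stdSimplex ℝ S → ℝ, IsValueFun v → ∀ (t : ℕ) (h : Hist Act Ob t) (a : Act),
    0 < P.infoProb b₀ π (.act h a : Info Act Ob (t + 1)) →
      ρ (t + 1) (fun i => v (P.beliefAt b₀ (t + 1) i)) (.act h a) =
        σ v (P.belief b₀ h) (P.beliefKernel (P.belief b₀ h) a)

end POMDP

/-! ### Nested discounted risk and the constrained problem -/

/-- `nestedRisk ρ Z n k = ρ_k (Z_k + ρ_{k+1} (Z_{k+1} + ⋯ + ρ_{k+n} (Z_{k+n}) ⋯ ))`. -/
def nestedRisk {Act Ob : Type*} (ρ : RiskSeq Act Ob) (Z : ∀ t : ℕ, Info Act Ob (t + 1) → ℝ) :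
    ℕ → ∀ k : ℕ, Info Act Ob k → ℝ
  | 0, k => ρ k (Z k)
  | n + 1, k => ρ k (Z k + nestedRisk ρ Z n (k + 1))

namespace POMDP

variable {S Act Ob : Type*} [Fintype S] [Fintype Act] [Fintype Ob]

/-- The discounted risk `ρ_{0,t}(c_0, γ c_1, …, γ^t c_t)` up to time `t`. -/
def finiteRisk (P : POMDP S Act Ob) (γ : ℝ) (b₀ : stdSimplex ℝ S) (ρ : RiskSeq Act Ob)
    (c : S → Act → ℝ) (t : ℕ) : ℝ :=
  nestedRisk ρ (fun k => γ ^ k • P.stageCost b₀ c k) t 0 .start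

/-- The total discounted risk `ρ^γ(c_0, c_1, …) = lim_{t → ∞} ρ_{0,t}(c_0, γ c_1, …, γ^t c_t)`. -/
def totalRisk (P : POMDP S Act Ob) (γ : ℝ) (b₀ : stdSimplex ℝ S) (ρ : RiskSeq Act Ob)
    (c : S → Act → ℝ) : ℝ :=
  limUnder atTop (P.finiteRisk γ b₀ ρ c)

/-- The value `J_γ(b₀)` of the constrained problem: the infimum of the total discounted risk of `c`
over the admissible policies `π ∈ Adm` for which the total discounted risk of each `d i` is at most
`β i` (and `+∞` if there is none). -/
def optimalValue (P : POMDP S Act Ob) (γ : ℝ) (b₀ : stdSimplex ℝ S) (Adm : Set (Policy Act Ob))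
    (ρ : Policy Act Ob → RiskSeq Act Ob) (c : S → Act → ℝ) {n : ℕ} (d : Fin n → S → Act → ℝ)
    (β : Fin n → ℝ) : EReal :=
  ⨅ π ∈ {π ∈ Adm | ∀ i, P.totalRisk γ b₀ (ρ π) (d i) ≤ β i},
    (P.totalRisk γ b₀ (ρ π) c : EReal)

/-! ### The optimization problem over value functions -/

/-- The feasible pairs `(V, lam)` of the optimization problem over value functions. -/
def IsFeasible (P : POMDP S Act Ob) (γ : ℝ)
    (σ : (stdSimplex ℝ S → ℝ) → stdSimplex ℝ S → PMF (stdSimplex ℝ S) → ℝ)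
    (c : S → Act → ℝ) {n : ℕ} (d : Fin n → S → Act → ℝ)
    (x : (stdSimplex ℝ S → ℝ) × (Fin n → ℝ)) : Prop :=
  IsValueFun x.1 ∧ 0 ≤ x.2 ∧
    ∀ (b : stdSimplex ℝ S) (a : Act),
      x.1 b ≤ beliefCost c b a + ∑ i, x.2 i * beliefCost (d i) b a
        + γ * σ x.1 b (P.beliefKernel b a)

/-- The objective `⟨b₀, V⟩ - ⟨lam, β⟩`. The belief MDP starts at `b₀`, so `⟨b₀, V⟩` is `V b₀`. -/
def dualObjective (b₀ : stdSimplex ℝ S) {n : ℕ} (β : Fin n → ℝ)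
    (x : (stdSimplex ℝ S → ℝ) × (Fin n → ℝ)) : ℝ :=
  x.1 b₀ - ∑ i, x.2 i * β i

/-- `x = (V, lam)` solves the optimization problem: it is feasible and maximizes the objective. -/
def IsSolution (P : POMDP S Act Ob) (γ : ℝ) (b₀ : stdSimplex ℝ S)
    (σ : (stdSimplex ℝ S → ℝ) → stdSimplex ℝ S → PMF (stdSimplex ℝ S) → ℝ)
    (c : S → Act → ℝ) {n : ℕ} (d : Fin n → S → Act → ℝ) (β : Fin n → ℝ)
    (x : (stdSimplex ℝ S → ℝ) × (Fin n → ℝ)) : Prop :=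
  P.IsFeasible γ σ c d x ∧
    ∀ y, P.IsFeasible γ σ c d y → dualObjective b₀ β y ≤ dualObjective b₀ β x

end POMDP

end

namespace POMDP

variable {S Act Ob : Type*} [Fintype S] [Fintype Act] [Fintype Ob]
  {P : POMDP S Act Ob} {b₀ : stdSimplex ℝ S} {π : Policy Act Ob} {ρ : RiskSeq Act Ob}

/-! This is weak Lagrangian duality by dynamic programming. Along the belief process of an
admissible policy, the Markov property turns `γ * σ` in the constraint into the conditional risk of
the next discounted value (`IsFeasible.le_stage`). Iterating, and bounding the last value by a
constant `C`, gives `V b₀ ≤ γ ^ (t + 1) * C` plus the nested risk of the Lagrangian cost `c + ∑ i,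
lam i * d i` (`IsFeasible.le_nestedRisk`). Coherent risk is sublinear and `lam ≥ 0`, so that nested
risk is at most the risk of `c` plus the weighted risks of the `d i`
(`IsCoherent.nestedRisk_add_sum_le`). As `t → ∞` the tail vanishes, and the risks of the `d i` are
at most `β i`. The limits exist because nested risks of nonnegative discounted costs increase with
the horizon and have a geometric bound. -/

theorem AELe.trans {t : ℕ} {X Y Z : Info Act Ob t → ℝ} (h₁ : P.AELe b₀ π X Y)
    (h₂ : P.AELe b₀ π Y Z) : P.AELe b₀ π X Z :=
  fun i hi => (h₁ i hi).trans (h₂ i hi)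

theorem AEEq.le {t : ℕ} {X Y : Info Act Ob t → ℝ} (h : P.AEEq b₀ π X Y) : P.AELe b₀ π X Y :=
  fun i hi => (h i hi).le

theorem AEEq.symm {t : ℕ} {X Y : Info Act Ob t → ℝ} (h : P.AEEq b₀ π X Y) : P.AEEq b₀ π Y X :=
  fun i hi => (h i hi).symm

theorem AELe.add {t : ℕ} {X Y X' Y' : Info Act Ob t → ℝ} (h : P.AELe b₀ π X Y)
    (h' : P.AELe b₀ π X' Y') : P.AELe b₀ π (X + X') (Y + Y') :=
  fun i hi => add_le_add (h i hi) (h' i hi)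

theorem AELe.of_le {t : ℕ} {X Y : Info Act Ob t → ℝ} (h : X ≤ Y) : P.AELe b₀ π X Y :=
  fun i _ => h i

/-! ### Sublinearity, monotonicity and bounds for nested coherent risk. -/

namespace IsCoherent

theorem congr (hρ : P.IsCoherent b₀ π ρ) {t : ℕ} {X Y : Info Act Ob (t + 1) → ℝ}
    (h : P.AEEq b₀ π X Y) : P.AEEq b₀ π (ρ t X) (ρ t Y) :=
  fun i hi => (hρ.monotone t X Y h.le i hi).antisymm (hρ.monotone t Y X h.symm.le i hi)

theorem map_zero (hρ : P.IsCoherent b₀ π ρ) (t : ℕ) : P.AEEq b₀ π (ρ t 0) 0 := by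
  simpa using hρ.homogeneous t 0 le_rfl 0

theorem const_add (hρ : P.IsCoherent b₀ π ρ) (t : ℕ) (r : ℝ) (Y : Info Act Ob (t + 1) → ℝ) :
    P.AEEq b₀ π (ρ t ((fun _ => r) + Y)) ((fun _ => r) + ρ t Y) :=
  hρ.translation t (fun _ => r) Y

theorem map_const (hρ : P.IsCoherent b₀ π ρ) (t : ℕ) (r : ℝ) :
    P.AEEq b₀ π (ρ t fun _ => r) fun _ => r := fun i hi => by
  have h := hρ.const_add t r 0 i hi
  rw [add_zero, Pi.add_apply, hρ.map_zero t i hi] at h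
  simpa using h

/-- Convexity at the midpoint of `2X` and `2Y`; homogeneity cancels the factors. -/
theorem subadditive (hρ : P.IsCoherent b₀ π ρ) (t : ℕ) (X Y : Info Act Ob (t + 1) → ℝ) :
    P.AELe b₀ π (ρ t (X + Y)) (ρ t X + ρ t Y) := fun i hi => by
  have h := hρ.convex t (1 / 2) (by norm_num) (by norm_num) ((2 : ℝ) • X) ((2 : ℝ) • Y) i hi
  have hX := hρ.homogeneous t 2 (by norm_num) X i hi
  have hY := hρ.homogeneous t 2 (by norm_num) Y i hi
  have e : (1 / 2 : ℝ) • ((2 : ℝ) • X) + (1 - 1 / 2 : ℝ) • ((2 : ℝ) • Y) = X + Y := by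
    rw [smul_smul, smul_smul]; norm_num
  rw [e] at h
  simp only [Pi.add_apply, Pi.smul_apply, smul_eq_mul] at h hX hY ⊢
  linarith

variable {Z Z' : ∀ t : ℕ, Info Act Ob (t + 1) → ℝ}

theorem nestedRisk_mono (hρ : P.IsCoherent b₀ π ρ) (h : ∀ k, P.AELe b₀ π (Z k) (Z' k)) :
    ∀ n k, P.AELe b₀ π (nestedRisk ρ Z n k) (nestedRisk ρ Z' n k)
  | 0, k => hρ.monotone k _ _ (h k)
  | n + 1, k => hρ.monotone k _ _ ((h k).add (nestedRisk_mono hρ h n (k + 1)))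

theorem nestedRisk_add_le (hρ : P.IsCoherent b₀ π ρ) :
    ∀ n k, P.AELe b₀ π (nestedRisk ρ (Z + Z') n k) (nestedRisk ρ Z n k + nestedRisk ρ Z' n k)
  | 0, k => hρ.subadditive k _ _
  | n + 1, k => by
    refine (hρ.monotone k _ _ ?_).trans (hρ.subadditive k (Z k + nestedRisk ρ Z n (k + 1))
      (Z' k + nestedRisk ρ Z' n (k + 1)))
    intro i hi
    have h := nestedRisk_add_le hρ n (k + 1) i hi
    simp only [Pi.add_apply] at h ⊢
    linarith

theorem nestedRisk_smul (hρ : P.IsCoherent b₀ π ρ) {r : ℝ} (hr : 0 ≤ r) :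
    ∀ n k, P.AEEq b₀ π (nestedRisk ρ (r • Z) n k) (r • nestedRisk ρ Z n k)
  | 0, k => hρ.homogeneous k r hr _
  | n + 1, k => by
    intro i hi
    refine (hρ.congr ?_ i hi).trans (hρ.homogeneous k r hr (Z k + nestedRisk ρ Z n (k + 1)) i hi)
    intro j hj
    have h := nestedRisk_smul hρ hr n (k + 1) j hj
    simp only [Pi.add_apply, Pi.smul_apply, smul_eq_mul] at h ⊢
    rw [h, mul_add]

theorem nestedRisk_add_sum_le (hρ : P.IsCoherent b₀ π ρ) {ι : Type*} (s : Finset ι)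
    (W : ι → ∀ t : ℕ, Info Act Ob (t + 1) → ℝ) (r : ι → ℝ) (hr : ∀ i, 0 ≤ r i) (n k : ℕ) :
    P.AELe b₀ π (nestedRisk ρ (Z + ∑ i ∈ s, r i • W i) n k)
      (nestedRisk ρ Z n k + ∑ i ∈ s, r i • nestedRisk ρ (W i) n k) := by
  classical
  induction s using Finset.induction_on with
  | empty => simpa using AELe.of_le le_rfl
  | insert i s hi ih =>
    intro j hj
    have h₁ := hρ.nestedRisk_add_le (Z := Z + ∑ i ∈ s, r i • W i) (Z' := r i • W i) n k j hj
    have h₂ := hρ.nestedRisk_smul (Z := W i) (hr i) n k j hj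
    have h₃ := ih j hj
    have e : Z + ∑ i ∈ insert i s, r i • W i = Z + ∑ i ∈ s, r i • W i + r i • W i := by
      rw [Finset.sum_insert hi]; abel
    rw [e, Finset.sum_insert hi]
    simp only [Pi.add_apply] at h₁ h₂ h₃ ⊢
    linarith

theorem nestedRisk_nonneg (hρ : P.IsCoherent b₀ π ρ) (hZ : ∀ k, P.AELe b₀ π 0 (Z k)) :
    ∀ n k, P.AELe b₀ π 0 (nestedRisk ρ Z n k)
  | 0, k => (hρ.map_zero k).symm.le.trans (hρ.monotone k _ _ (hZ k))
  | n + 1, k => (hρ.map_zero k).symm.le.trans (hρ.monotone k _ _ (by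
      simpa using (hZ k).add (nestedRisk_nonneg hρ hZ n (k + 1))))

/-- A longer horizon only adds a nonnegative risk inside the innermost mapping, and monotonicity
carries this outward. -/
theorem nestedRisk_le_succ (hρ : P.IsCoherent b₀ π ρ) (hZ : ∀ k, P.AELe b₀ π 0 (Z k)) :
    ∀ n k, P.AELe b₀ π (nestedRisk ρ Z n k) (nestedRisk ρ Z (n + 1) k)
  | 0, k => hρ.monotone k _ _ (by
      simpa using (AELe.of_le (le_refl (Z k))).add (hρ.nestedRisk_nonneg hZ 0 (k + 1)))
  | n + 1, k => hρ.monotone k _ _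
      ((AELe.of_le le_rfl).add (nestedRisk_le_succ hρ hZ n (k + 1)))

/-- The constant `C / (1 - γ)` is the fixed point of `y ↦ C + γ * y`, so the bound reproduces itself
at each level. -/
theorem nestedRisk_le_geometric (hρ : P.IsCoherent b₀ π ρ) {γ C : ℝ} (hγ₀ : 0 ≤ γ) (hγ₁ : γ < 1)
    (hC : 0 ≤ C) (hZ : ∀ k, P.AELe b₀ π (Z k) fun _ => γ ^ k * C) :
    ∀ n k, P.AELe b₀ π (nestedRisk ρ Z n k) fun _ => γ ^ k * (C / (1 - γ))
  | 0, k => by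
    refine (hρ.monotone k _ _ ((hZ k).trans (AELe.of_le fun _ => ?_))).trans
      (hρ.map_const k _).le
    have h : 0 < 1 - γ := sub_pos.2 hγ₁
    exact mul_le_mul_of_nonneg_left (le_div_self hC h (by linarith)) (pow_nonneg hγ₀ k)
  | n + 1, k => by
    refine (hρ.monotone k _ _ (((hZ k).add
      (nestedRisk_le_geometric hρ hγ₀ hγ₁ hC hZ n (k + 1))).trans
        (AELe.of_le fun _ => le_of_eq ?_))).trans (hρ.map_const k _).le
    have h : 1 - γ ≠ 0 := (sub_pos.2 hγ₁).ne'
    simp only [Pi.add_apply]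
    field_simp
    ring

end IsCoherent

/-! ### Uniform cost bounds and existence of the total risk. -/

omit [Fintype Act] in
theorem beliefCost_nonneg {c : S → Act → ℝ} (hc : ∀ s a, 0 ≤ c s a) (b : stdSimplex ℝ S)
    (a : Act) : 0 ≤ beliefCost c b a :=
  Finset.sum_nonneg fun s _ => mul_nonneg (hc s a) (b.2.1 s)

theorem beliefCost_le_sum {c : S → Act → ℝ} (hc : ∀ s a, 0 ≤ c s a) (b : stdSimplex ℝ S)
    (a : Act) : beliefCost c b a ≤ ∑ s, ∑ a, c s a := by
  refine Finset.sum_le_sum fun s _ => ?_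
  have hb : b s ≤ 1 := b.2.2 ▸ Finset.single_le_sum (fun s _ => b.2.1 s) (Finset.mem_univ s)
  exact (mul_le_of_le_one_right (hc s a) hb).trans
    (Finset.single_le_sum (fun a _ => hc s a) (Finset.mem_univ a))

omit [Fintype Act] in
theorem stageCost_nonneg {c : S → Act → ℝ} (hc : ∀ s a, 0 ≤ c s a) (t : ℕ)
    (i : Info Act Ob (t + 1)) : 0 ≤ P.stageCost b₀ c t i := by
  cases i with
  | act h a => exact beliefCost_nonneg hc _ a

theorem stageCost_le_sum {c : S → Act → ℝ} (hc : ∀ s a, 0 ≤ c s a) (t : ℕ)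
    (i : Info Act Ob (t + 1)) : P.stageCost b₀ c t i ≤ ∑ s, ∑ a, c s a := by
  cases i with
  | act h a => exact beliefCost_le_sum hc _ a

/-- Evaluating at this atom turns almost sure relations at stage `0` into relations between real
numbers. -/
theorem infoProb_start_pos : 0 < P.infoProb b₀ π (Info.start : Info Act Ob 0) := by
  simp [infoProb]

/-- The discounted risks of nonnegative costs increase to the total discounted risk. -/
theorem IsCoherent.tendsto_finiteRisk (hρ : P.IsCoherent b₀ π ρ) {γ : ℝ} (hγ₀ : 0 ≤ γ)
    (hγ₁ : γ < 1) {c : S → Act → ℝ} (hc : ∀ s a, 0 ≤ c s a) :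
    Tendsto (P.finiteRisk γ b₀ ρ c) atTop (𝓝 (P.totalRisk γ b₀ ρ c)) := by
  have hZ : ∀ k, P.AELe b₀ π 0 (γ ^ k • P.stageCost b₀ c k) := fun k => AELe.of_le fun i =>
    mul_nonneg (pow_nonneg hγ₀ k) (stageCost_nonneg hc k i)
  have hmono : Monotone (P.finiteRisk γ b₀ ρ c) := monotone_nat_of_le_succ fun t =>
    hρ.nestedRisk_le_succ hZ t 0 .start infoProb_start_pos
  have hbdd : BddAbove (Set.range (P.finiteRisk γ b₀ ρ c)) := by
    refine ⟨γ ^ 0 * ((∑ s, ∑ a, c s a) / (1 - γ)), ?_⟩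
    rintro _ ⟨t, rfl⟩
    exact hρ.nestedRisk_le_geometric hγ₀ hγ₁
      (Finset.sum_nonneg fun s _ => Finset.sum_nonneg fun a _ => hc s a)
      (fun k => AELe.of_le fun i =>
        mul_le_mul_of_nonneg_left (stageCost_le_sum hc k i) (pow_nonneg hγ₀ k))
      t 0 .start infoProb_start_pos
  exact tendsto_nhds_limUnder ⟨_, tendsto_atTop_ciSup hmono hbdd⟩

/-! ### Bellman iteration and weak duality. -/

section Feasible

variable {σ : (stdSimplex ℝ S → ℝ) → stdSimplex ℝ S → PMF (stdSimplex ℝ S) → ℝ}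
  {γ : ℝ} {c : S → Act → ℝ} {n : ℕ} {d : Fin n → S → Act → ℝ}
  {x : (stdSimplex ℝ S → ℝ) × (Fin n → ℝ)}

/-- One step of the recursion satisfied by a feasible value function along the belief process. -/
theorem IsFeasible.le_stage (hx : P.IsFeasible γ σ c d x) (hρ : P.IsCoherent b₀ π ρ)
    (hσ : P.IsMarkovRisk b₀ π ρ σ) (hγ₀ : 0 ≤ γ) (k : ℕ) :
    P.AELe b₀ π (γ ^ k • fun i => x.1 (P.beliefAt b₀ k i))
      ((γ ^ k • (P.stageCost b₀ c k + ∑ i, x.2 i • P.stageCost b₀ (d i) k)) +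
        ρ (k + 1) (γ ^ (k + 1) • fun i => x.1 (P.beliefAt b₀ (k + 1) i))) := by
  intro j hj
  have hhom := hρ.homogeneous (k + 1) (γ ^ (k + 1)) (pow_nonneg hγ₀ _)
    (fun i => x.1 (P.beliefAt b₀ (k + 1) i)) j hj
  cases j with
  | act h a =>
    -- Homogeneity has moved the discount outside, so the Markov property applies to the
    -- undiscounted `V`.
    rw [Pi.smul_apply, smul_eq_mul, hσ x.1 hx.1 k h a hj] at hhom
    rw [Pi.add_apply, hhom]
    have hV := mul_le_mul_of_nonneg_left (hx.2.2 (P.belief b₀ h) a) (pow_nonneg hγ₀ k)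
    simp only [Pi.smul_apply, smul_eq_mul, Pi.add_apply, Finset.sum_apply, beliefAt, stageCost]
    refine hV.trans (le_of_eq ?_)
    ring

/-- A feasible value function is bounded by the nested risk of the Lagrangian costs, up to the
discounted bound of the value function. -/
theorem IsFeasible.le_nestedRisk (hx : P.IsFeasible γ σ c d x) (hρ : P.IsCoherent b₀ π ρ)
    (hσ : P.IsMarkovRisk b₀ π ρ σ) (hγ₀ : 0 ≤ γ) {C : ℝ} (hC : ∀ b, x.1 b ≤ C) :
    ∀ m k, P.AELe b₀ π (ρ k (γ ^ k • fun i => x.1 (P.beliefAt b₀ k i)))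
      ((fun _ => γ ^ (k + m + 1) * C) + nestedRisk ρ
        (fun k => γ ^ k • (P.stageCost b₀ c k + ∑ i, x.2 i • P.stageCost b₀ (d i) k)) m k)
  | 0, k => by
    refine (hρ.monotone k _ _ ((hx.le_stage hρ hσ hγ₀ k).trans ?_)).trans
      (hρ.const_add k _ _).le
    rw [add_comm (fun _ => γ ^ (k + 0 + 1) * C)]
    exact (AELe.of_le le_rfl).add ((hρ.monotone (k + 1) _ _ (AELe.of_le fun i =>
      mul_le_mul_of_nonneg_left (hC _) (pow_nonneg hγ₀ _))).trans (hρ.map_const (k + 1) _).le)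
  | m + 1, k => by
    refine (hρ.monotone k _ _ ((hx.le_stage hρ hσ hγ₀ k).trans ?_)).trans
      (hρ.const_add k _ _).le
    have ih := hx.le_nestedRisk hρ hσ hγ₀ hC m (k + 1)
    -- The tail constant depends only on the final time, so it passes unchanged through every risk
    -- mapping by translation.
    rw [show k + 1 + m + 1 = k + (m + 1) + 1 by ring] at ih
    rw [add_left_comm]
    exact (AELe.of_le le_rfl).add ih

theorem IsFeasible.le_finiteRisk (hx : P.IsFeasible γ σ c d x) (hρ : P.IsCoherent b₀ π ρ)
    (hσ : P.IsMarkovRisk b₀ π ρ σ) (hγ₀ : 0 ≤ γ) {C : ℝ} (hC : ∀ b, x.1 b ≤ C) (t : ℕ) :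
    x.1 b₀ ≤ γ ^ (t + 1) * C +
      (P.finiteRisk γ b₀ ρ c t + ∑ i, x.2 i * P.finiteRisk γ b₀ ρ (d i) t) := by
  -- The only history at time `0` is empty, so the initial value is a constant, which `ρ 0`
  -- preserves.
  have h₀ : (fun _ => x.1 b₀) = γ ^ 0 • fun i => x.1 (P.beliefAt b₀ 0 i) := by
    funext i
    cases i with
    | act h a => cases h; simp [beliefAt, belief]
  have h₁ := hρ.map_const 0 (x.1 b₀) .start infoProb_start_pos
  have h₂ := hx.le_nestedRisk hρ hσ hγ₀ hC t 0 .start infoProb_start_pos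
  have h₃ := hρ.nestedRisk_add_sum_le (Z := fun k => γ ^ k • P.stageCost b₀ c k) Finset.univ
    (fun i k => γ ^ k • P.stageCost b₀ (d i) k) x.2 hx.2.1 t 0 .start infoProb_start_pos
  have e : ((fun k => γ ^ k • P.stageCost b₀ c k) +
      ∑ i, x.2 i • (fun k => γ ^ k • P.stageCost b₀ (d i) k) :
        ∀ k : ℕ, Info Act Ob (k + 1) → ℝ) =
      fun k => γ ^ k • (P.stageCost b₀ c k + ∑ i, x.2 i • P.stageCost b₀ (d i) k) := by
    funext k
    simp only [Pi.add_apply, Finset.sum_apply, Pi.smul_apply, smul_add, Finset.smul_sum]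
    congr 1
    exact Finset.sum_congr rfl fun i _ => smul_comm _ _ _
  rw [e] at h₃
  rw [← h₀, h₁, Nat.zero_add] at h₂
  simp only [Pi.add_apply, Finset.sum_apply, Pi.smul_apply, smul_eq_mul] at h₂ h₃
  exact h₂.trans (add_le_add le_rfl h₃)

/-- Weak duality: the objective of a feasible pair is at most the risk of each policy that satisfies
the constraints. -/
theorem IsFeasible.dualObjective_le_totalRisk (hx : P.IsFeasible γ σ c d x)
    (hρ : P.IsCoherent b₀ π ρ) (hσ : P.IsMarkovRisk b₀ π ρ σ) (hγ₀ : 0 ≤ γ) (hγ₁ : γ < 1)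
    (hc : ∀ s a, 0 ≤ c s a) (hd : ∀ i s a, 0 ≤ d i s a) {β : Fin n → ℝ}
    (hβ : ∀ i, P.totalRisk γ b₀ ρ (d i) ≤ β i) :
    dualObjective b₀ β x ≤ P.totalRisk γ b₀ ρ c := by
  obtain ⟨C, hC⟩ := hx.1.2
  have hlim : Tendsto (fun t => γ ^ (t + 1) * C +
      (P.finiteRisk γ b₀ ρ c t + ∑ i, x.2 i * P.finiteRisk γ b₀ ρ (d i) t)) atTop
      (𝓝 (0 * C + (P.totalRisk γ b₀ ρ c + ∑ i, x.2 i * P.totalRisk γ b₀ ρ (d i)))) :=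
    ((((tendsto_add_atTop_iff_nat 1).2 (tendsto_pow_atTop_nhds_zero_of_lt_one hγ₀ hγ₁)).mul_const
      C).add ((hρ.tendsto_finiteRisk hγ₀ hγ₁ hc).add (tendsto_finsetSum _ fun i _ =>
        (hρ.tendsto_finiteRisk hγ₀ hγ₁ (hd i)).const_mul _)))
  have h := ge_of_tendsto' hlim fun t =>
    hx.le_finiteRisk hρ hσ hγ₀ (fun b => (le_abs_self _).trans (hC b)) t
  -- Nonnegative multipliers serve a second time here, after the splitting of the Lagrangian risk.
  have hsum : ∑ i, x.2 i * P.totalRisk γ b₀ ρ (d i) ≤ ∑ i, x.2 i * β i :=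
    Finset.sum_le_sum fun i _ => mul_le_mul_of_nonneg_left (hβ i) (hx.2.1 i)
  rw [dualObjective]
  linarith

end Feasible

end POMDP

theorem theorem2 {S Act Ob : Type*} [Fintype S] [Fintype Act] [Fintype Ob]
    (P : POMDP S Act Ob) (b₀ : stdSimplex ℝ S)
    (γ : ℝ) (hγ₀ : 0 < γ) (hγ₁ : γ < 1)
    (c : S → Act → ℝ) (hc : ∀ s a, 0 ≤ c s a)
    {n : ℕ} (d : Fin n → S → Act → ℝ) (hd : ∀ i s a, 0 ≤ d i s a) (β : Fin n → ℝ)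
    (Adm : Set (Policy Act Ob))
    (ρ : Policy Act Ob → RiskSeq Act Ob)
    (σ : (stdSimplex ℝ S → ℝ) → stdSimplex ℝ S → PMF (stdSimplex ℝ S) → ℝ)
    (hcoh : ∀ π ∈ Adm, P.IsCoherent b₀ π (ρ π))
    (hmarkov : ∀ π ∈ Adm, P.IsMarkovRisk b₀ π (ρ π) σ) :
    -- the total discounted risks are well defined
    (∀ π ∈ Adm,
      Filter.Tendsto (P.finiteRisk γ b₀ (ρ π) c) Filter.atTop
        (nhds (P.totalRisk γ b₀ (ρ π) c)) ∧
      ∀ i, Filter.Tendsto (P.finiteRisk γ b₀ (ρ π) (d i)) Filter.atTop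
        (nhds (P.totalRisk γ b₀ (ρ π) (d i)))) ∧
    -- each solution of the optimization problem gives a lower bound
    (∀ x : (stdSimplex ℝ S → ℝ) × (Fin n → ℝ), P.IsSolution γ b₀ σ c d β x →
      (POMDP.dualObjective b₀ β x : EReal) ≤ P.optimalValue γ b₀ Adm ρ c d β) ∧
    -- and so does its supremum, whether or not it is attained
    (⨆ x ∈ {x : (stdSimplex ℝ S → ℝ) × (Fin n → ℝ) | P.IsFeasible γ σ c d x},
      (POMDP.dualObjective b₀ β x : EReal)) ≤ P.optimalValue γ b₀ Adm ρ c d β := by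
  have hweak : ∀ x : (stdSimplex ℝ S → ℝ) × (Fin n → ℝ), P.IsFeasible γ σ c d x →
      (POMDP.dualObjective b₀ β x : EReal) ≤ P.optimalValue γ b₀ Adm ρ c d β := fun x hx =>
    le_iInf₂ fun π hπ => EReal.coe_le_coe_iff.2 <|
      hx.dualObjective_le_totalRisk (hcoh π hπ.1) (hmarkov π hπ.1) hγ₀.le hγ₁ hc hd hπ.2
  exact ⟨fun π hπ => ⟨(hcoh π hπ).tendsto_finiteRisk hγ₀.le hγ₁ hc,
      fun i => (hcoh π hπ).tendsto_finiteRisk hγ₀.le hγ₁ (hd i)⟩,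
    fun x hx => hweak x hx.1, iSup₂_le fun x hx => hweak x hx⟩
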